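/- Let $G$ be a finite, connected, chordal graph with vertex set $V$. Let $\mathcal C$ be the set of its maximal cliques and $\mathcal S$ the set of its minimal vertex separators, i.e. of those $S\subseteq V$ such that, for some vertices $a,b\in V\setminus S$, $S$ separates $a$ from $b$ in $G$ and no proper subset of $S$ does. For $S\in\mathcal S$ let $\Gamma_1,\dots,\Gamma_M$ be (the vertex sets of) the connected components of the induced subgraph $G(V\setminus S)$, and put $$\mathcal M_S=\{m : N_G(\Gamma_m)=S\},\qquad \mathcal C_{\uparrow S}(\Gamma_m\cup S)=\{C\in\mathcal C : C\subseteq \Gamma_m\cup S,\ C\supsetneq S\},$$ where $N_G(U)=\bigcup_{v\in U}N_G(v)\setminus U$ for $U\subseteq V$. Consider the conditions (i) $|\mathcal S|=|\mathcal C|-1$; (ii) no element of $\mathcal S$ is properly contained in another element of $\mathcal S$. Then (i) and (ii) both hold if and only if for every $S\in\mathcal S$ we have $|\mathcal M_S|=2$ and $|\mathcal C_{\uparrow S}(\Gamma_m\cup S)|=1$ for every $m=1,\dots,M$. The equivalence also holds if the last equality is required only for $m\in\mathcal M_S$. Moreover, if (i) and (ii) hold, then for every $S\in\mathcal S$ the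 corresponding factor $$\Bigl(\sum_{m\in\mathcal M_S}|\mathcal C_{\uparrow S}(\Gamma_m\cup S)|\Bigr)^{|\mathcal M_S|-2}\cdot\prod_{m\in\mathcal M_S}|\mathcal C_{\uparrow S}(\Gamma_m\cup S)|$$ in Ho and Lee's product formula for the number of clique trees of $G$ equals $1$. -/

import Mathlib

namespace SimpleGraph

variable {V : Type*}

/-- A graph is chordal if every cycle of length at least four has a chord, i.e. an edge of the graph
that joins two vertices of the cycle and is not an edge of the cycle. -/
def IsChordal (G : SimpleGraph V) : Prop :=
  ∀ ⦃v : V⦄ (p : G.Walk v v), p.IsCycle → 4 ≤ p.length →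
    ∃ x ∈ p.support, ∃ y ∈ p.support, G.Adj x y ∧ s(x, y) ∉ p.edges

/-- The set `𝒞` of maximal cliques of `G`. -/
def maximalCliques (G : SimpleGraph V) : Set (Set V) :=
  {C | Maximal G.IsClique C}

/-- `S` separates `a` and `b`: neither vertex lies in `S`, and they lie in different connected
components of the graph induced on the complement of `S`. -/
def Separates (G : SimpleGraph V) (S : Set V) (a b : V) : Prop :=
  ∃ (ha : a ∈ Sᶜ) (hb : b ∈ Sᶜ), ¬ (G.induce Sᶜ).Reachable ⟨a, ha⟩ ⟨b, hb⟩

/-- The set `𝒮` of minimal vertex separators of `G`: the sets `S` that, for some pair of vertices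
`a`, `b`, separate `a` and `b` while no proper subset of `S` does. -/
def minimalVertexSeparators (G : SimpleGraph V) : Set (Set V) :=
  {S | ∃ a b : V, Minimal (fun T : Set V => G.Separates T a b) S}

/-- The connected components of `G(V ∖ S)`. -/
abbrev SepComponent (G : SimpleGraph V) (S : Set V) : Type _ :=
  (G.induce Sᶜ).ConnectedComponent

/-- The vertex set `Γ ⊆ V` of a connected component of `G(V ∖ S)`. -/
def SepComponent.verts {G : SimpleGraph V} {S : Set V} (Γ : G.SepComponent S) : Set V :=
  Subtype.val '' (ConnectedComponent.supp Γ)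

/-- The open neighbourhood `N_G(U) = (⋃ v ∈ U, N_G(v)) ∖ U` of a set of vertices. -/
def openNeighborhood (G : SimpleGraph V) (U : Set V) : Set V :=
  (⋃ v ∈ U, G.neighborSet v) \ U

/-- `ℳ_S`: the connected components `Γ` of `G(V ∖ S)` with `N_G(Γ) = S`. -/
def fullComponents (G : SimpleGraph V) (S : Set V) : Set (G.SepComponent S) :=
  {Γ | G.openNeighborhood Γ.verts = S}

/-- `𝒞_{↑S}(Γ ∪ S)`: the maximal cliques `C` of `G` with `C ⊆ Γ ∪ S` and `S ⊂ C`. -/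
def cliquesAbove (G : SimpleGraph V) (S : Set V) (Γ : G.SepComponent S) : Set (Set V) :=
  {C | C ∈ G.maximalCliques ∧ C ⊆ Γ.verts ∪ S ∧ S ⊂ C}

/-- The factor belonging to `S` in Ho and Lee's product formula for the number of clique trees. The
exponent `|ℳ_S| - 2` is an integer. -/
noncomputable def hoLeeFactor (G : SimpleGraph V) (S : Set V) : ℚ :=
  (∑ᶠ Γ ∈ G.fullComponents S, ((G.cliquesAbove S Γ).ncard : ℚ)) ^
      (((G.fullComponents S).ncard : ℤ) - 2) *
    ∏ᶠ Γ ∈ G.fullComponents S, ((G.cliquesAbove S Γ).ncard : ℚ)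

/-- Conditions (i) `|𝒮| = |𝒞| - 1` and (ii) no minimal vertex separator is properly contained in
another one. -/
def UniquenessConditions (G : SimpleGraph V) : Prop :=
  (G.minimalVertexSeparators.ncard : ℤ) = (G.maximalCliques.ncard : ℤ) - 1 ∧
    IsAntichain (· ⊆ ·) G.minimalVertexSeparators

end SimpleGraph

namespace SimpleGraph

variable {V : Type*} {G : SimpleGraph V}

/-! Everything reduces to the antichain condition (ii). Chordality makes minimal separators cliques,
and puts a maximal clique above such an `S` in each full component (`IsChordal.exists_adj_all`).
Under (ii) every component is full and has exactly one clique above `S`. Fix a maximal clique `C₀`: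
every other maximal clique is then the clique above `S` in `Γ` for exactly one pair `(S, Γ)` with
`C₀` not inside `Γ ∪ S`. Each `S` excludes one component, so `|𝒞| - 1 = ∑ (|ℳ_S| - 1)`. All terms
are at least 1, hence (i) says exactly that all `|ℳ_S|` equal 2.

Conversely, if `T ⊂ S` are minimal separators, cliques above `S` in two full components both lie
above `T` in one component, so uniqueness above separators forces (ii). -/

/-! ### Chordless paths in chordal graphs -/

theorem Walk.isChordless_of_length_eq_dist {u v : V} (p : G.Walk u v) (hp : p.length = G.dist u v) :
    p.IsChordless := by
  rw [Walk.isChordless_iff_forall_mem_edges]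
  have key : ∀ i j : ℕ, i < j → j ≤ p.length → G.Adj (p.getVert i) (p.getVert j) →
      s(p.getVert i, p.getVert j) ∈ p.edges := by
    intro i j hij hj hadj
    -- The shortcut through the edge is no shorter than `p` only if `j = i + 1`.
    have hle := dist_le ((p.take i).append (Walk.cons hadj (p.drop j)))
    simp only [Walk.length_append, Walk.length_cons, Walk.take_length, Walk.drop_length] at hle
    obtain rfl : j = i + 1 := by omega
    exact p.mk_mem_edges_iff_exists.2 ⟨i, by omega, rfl⟩
  intro a b ha hb hab
  obtain ⟨i, rfl, hi⟩ := Walk.mem_support_iff_exists_getVert.1 ha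
  obtain ⟨j, rfl, hj⟩ := Walk.mem_support_iff_exists_getVert.1 hb
  rcases lt_trichotomy i j with h | rfl | h
  · exact key i j h hj hab
  · exact absurd hab (G.loopless.irrefl _)
  · rw [Sym2.eq_swap]
    exact key j i h hi hab.symm

/-- A path between `x` and `y` inside `X` can be chosen without chords in `G`. -/
theorem exists_isPath_isChordless {X : Set V} {x y : X} (h : (G.induce X).Reachable x y) :
    ∃ p : G.Walk x y, p.IsPath ∧ (∀ v ∈ p.support, v ∈ X) ∧ p.IsChordless := by
  obtain ⟨p, hp, hd⟩ := h.exists_path_of_dist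
  have hc := p.isChordless_of_length_eq_dist hd
  obtain ⟨q, hq, hqs, hqe⟩ : ∃ q : G.Walk x y, q.IsPath ∧ q.support = p.support.map Subtype.val ∧
      q.edges = p.edges.map (Sym2.map Subtype.val) :=
    ⟨p.map (Embedding.induce X).toHom, hp.map (Embedding.induce (G := G) X).injective,
      Walk.support_map _ _, Walk.edges_map _ _⟩
  refine ⟨q, hq, ?_, ?_⟩
  · intro v hv
    rw [hqs] at hv
    obtain ⟨w, -, rfl⟩ := List.mem_map.1 hv
    exact w.2
  · rw [Walk.isChordless_iff_forall_mem_edges] at hc ⊢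
    intro a b ha hb hab
    rw [hqs] at ha hb
    obtain ⟨a, ha', rfl⟩ := List.mem_map.1 ha
    obtain ⟨b, hb', rfl⟩ := List.mem_map.1 hb
    rw [hqe]
    exact List.mem_map.2 ⟨s(a, b), hc ha' hb' hab, rfl⟩

theorem Walk.two_le_length_of_not_adj {x y : V} (p : G.Walk x y) (hne : x ≠ y) (h : ¬ G.Adj x y) :
    2 ≤ p.length := by
  by_contra! hlt
  rcases Nat.lt_or_ge 0 p.length with h0 | h0
  · exact h (Walk.adj_of_length_eq_one (show p.length = 1 by omega))
  · exact hne (Walk.eq_of_length_eq_zero (show p.length = 0 by omega))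

/-- In a chordal graph, two nonadjacent vertices are not joined through two disjoint vertex sets
without edges between them. -/
theorem IsChordal.adj_of_reachable (hG : G.IsChordal) {x y : V} (hne : x ≠ y) {A B : Set V}
    (hAB : Disjoint A B) (hnadj : ∀ a ∈ A, ∀ b ∈ B, ¬ G.Adj a b)
    (hA : (G.induce (insert x (insert y A))).Reachable ⟨x, by simp⟩ ⟨y, by simp⟩)
    (hB : (G.induce (insert x (insert y B))).Reachable ⟨x, by simp⟩ ⟨y, by simp⟩) :
    G.Adj x y := by
  by_contra hxy
  obtain ⟨p, hp, hpA, hpc⟩ := exists_isPath_isChordless hA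
  obtain ⟨q, hq, hqB, hqc⟩ := exists_isPath_isChordless hB
  dsimp only at p q hp hq hpA hqB hpc hqc
  rw [Walk.isChordless_iff_forall_mem_edges] at hpc hqc
  have hp2 := p.two_le_length_of_not_adj hne hxy
  have hq2 := q.two_le_length_of_not_adj hne hxy
  have hcyc : (p.append q.reverse).IsCycle := by
    refine hp.isCycle_append hq.reverse (fun v hv hv' => ?_) (Or.inl (by omega))
    have hvx : v ≠ x := by
      rintro rfl
      have := hp.support_nodup
      rw [← Walk.cons_tail_support] at this
      exact (List.nodup_cons.1 this).1 hv
    have hvy : v ≠ y := by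
      rintro rfl
      have := hq.reverse.support_nodup
      rw [← Walk.cons_tail_support] at this
      exact (List.nodup_cons.1 this).1 hv'
    have h1 := hpA v (List.mem_of_mem_tail hv)
    have h2 := hqB v (by simpa using List.mem_of_mem_tail hv')
    simp only [Set.mem_insert_iff, hvx, hvy, false_or] at h1 h2
    exact hAB.le_bot ⟨h1, h2⟩
  obtain ⟨a, ha, b, hb, hab, hne'⟩ := hG _ hcyc (by simp; omega)
  simp only [Walk.mem_support_append_iff, Walk.support_reverse, List.mem_reverse,
    Walk.edges_append, Walk.edges_reverse, List.mem_append, not_or] at ha hb hne'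
  have hcross : ∀ a b, a ∈ p.support → b ∈ q.support → G.Adj a b →
      s(a, b) ∉ p.edges → s(a, b) ∉ q.edges → False := by
    intro a b ha hb hab hep heq
    have hap := hpA a ha
    have hbq := hqB b hb
    simp only [Set.mem_insert_iff] at hap hbq
    rcases hap with rfl | rfl | hap
    · exact heq (hqc q.start_mem_support hb hab)
    · exact heq (hqc q.end_mem_support hb hab)
    · rcases hbq with rfl | rfl | hbq
      · exact hep (hpc ha p.start_mem_support hab)
      · exact hep (hpc ha p.end_mem_support hab)
      · exact hnadj a hap b hbq hab
  rcases ha with ha | ha <;> rcases hb with hb | hb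
  · exact hne'.1 (hpc ha hb hab)
  · exact hcross a b ha hb hab hne'.1 hne'.2
  · exact hcross b a hb ha hab.symm (by rw [Sym2.eq_swap]; exact hne'.1)
      (by rw [Sym2.eq_swap]; exact hne'.2)
  · exact hne'.2 (hqc ha hb hab)

/-! ### Components of `G(V ∖ S)` -/

/-- A set containing `x` and closed under adjacency within `X` contains everything reachable from
`x` within `X`. -/
theorem Reachable.mem_of_closed {X U : Set V} {x y : X} (h : (G.induce X).Reachable x y)
    (hU : ∀ v ∈ U, ∀ w ∈ X, G.Adj v w → w ∈ U) (hx : (x : V) ∈ U) : (y : V) ∈ U := by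
  obtain ⟨p⟩ := h
  induction p with
  | nil => exact hx
  | @cons u v w huv _ ih => exact ih (hU _ hx _ v.2 huv)

theorem Reachable.induce_mono {X Y : Set V} (hXY : X ⊆ Y) {x y : V} {hx : x ∈ X} {hy : y ∈ X}
    (h : (G.induce X).Reachable ⟨x, hx⟩ ⟨y, hy⟩) :
    (G.induce Y).Reachable ⟨x, hXY hx⟩ ⟨y, hXY hy⟩ :=
  h.map (G.induceHomOfLE hXY).toHom

theorem Adj.reachable_induce {X : Set V} {x y : V} (h : G.Adj x y) (hx : x ∈ X) (hy : y ∈ X) :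
    (G.induce X).Reachable ⟨x, hx⟩ ⟨y, hy⟩ :=
  Adj.reachable (G := G.induce X) (u := ⟨x, hx⟩) (v := ⟨y, hy⟩) h

/-- The component of `G(V ∖ S)` containing a vertex outside `S`. -/
abbrev sepComponentMk (G : SimpleGraph V) {S : Set V} (a : V) (ha : a ∉ S) : G.SepComponent S :=
  (G.induce Sᶜ).connectedComponentMk ⟨a, ha⟩

namespace SepComponent

variable {S T : Set V} {Γ Γ' : G.SepComponent S} {a b v w : V}

theorem mem_verts_iff : a ∈ Γ.verts ↔ ∃ ha : a ∉ S, G.sepComponentMk a ha = Γ := by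
  constructor
  · rintro ⟨x, hx, rfl⟩
    exact ⟨x.2, hx⟩
  · rintro ⟨ha, h⟩
    exact ⟨⟨a, ha⟩, h, rfl⟩

theorem mem_verts_mk (ha : a ∉ S) : a ∈ (G.sepComponentMk a ha).verts :=
  mem_verts_iff.2 ⟨ha, rfl⟩

theorem notMem_of_mem_verts (h : a ∈ Γ.verts) : a ∉ S := (mem_verts_iff.1 h).1

theorem eq_of_mem (h : a ∈ Γ.verts) (h' : a ∈ Γ'.verts) : Γ = Γ' := by
  obtain ⟨_, rfl⟩ := mem_verts_iff.1 h
  obtain ⟨_, rfl⟩ := mem_verts_iff.1 h'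
  rfl

theorem verts_nonempty (Γ : G.SepComponent S) : ∃ a, a ∈ Γ.verts := by
  induction Γ using ConnectedComponent.ind with
  | h a => exact ⟨a, mem_verts_mk a.2⟩

theorem mem_verts_of_adj (hv : v ∈ Γ.verts) (h : G.Adj v w) (hw : w ∉ S) : w ∈ Γ.verts := by
  obtain ⟨hvS, rfl⟩ := mem_verts_iff.1 hv
  exact mem_verts_iff.2 ⟨hw, ConnectedComponent.sound (h.symm.reachable_induce hw hvS)⟩

theorem verts_subset_of_closed {U : Set V} (hv : v ∈ Γ.verts) (hvU : v ∈ U)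
    (hU : ∀ x ∈ U, ∀ y ∉ S, G.Adj x y → y ∈ U) : Γ.verts ⊆ U := by
  obtain ⟨hvS, rfl⟩ := mem_verts_iff.1 hv
  intro w hw
  obtain ⟨hwS, h⟩ := mem_verts_iff.1 hw
  exact (ConnectedComponent.exact h.symm).mem_of_closed (x := ⟨v, hvS⟩) (y := ⟨w, hwS⟩) hU hvU

theorem reachable_induce (ha : a ∈ Γ.verts) (hb : b ∈ Γ.verts) :
    (G.induce Γ.verts).Reachable ⟨a, ha⟩ ⟨b, hb⟩ := by
  have : Γ.verts ⊆ {x | ∃ hx : x ∈ Γ.verts, (G.induce Γ.verts).Reachable ⟨a, ha⟩ ⟨x, hx⟩} := by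
    refine verts_subset_of_closed ha ⟨ha, Reachable.refl _⟩ ?_
    rintro x ⟨hx, hr⟩ y hy hxy
    exact ⟨mem_verts_of_adj hx hxy hy,
      hr.trans (hxy.reachable_induce hx (mem_verts_of_adj hx hxy hy))⟩
  exact (this hb).2

/-- Connected sets avoiding `T` lie in one component of `G(V ∖ T)`. -/
theorem verts_subset_verts {Δ : G.SepComponent T} (hT : ∀ x ∈ Γ.verts, x ∉ T) (ha : a ∈ Γ.verts)
    (ha' : a ∈ Δ.verts) : Γ.verts ⊆ Δ.verts := by
  intro b hb
  obtain ⟨haT, rfl⟩ := mem_verts_iff.1 ha'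
  exact mem_verts_iff.2 ⟨hT b hb, ConnectedComponent.sound
    ((reachable_induce hb ha).induce_mono hT)⟩

end SepComponent

open SepComponent

variable {S T C : Set V}

/-! ### Full components and minimal separators -/

theorem mem_openNeighborhood {U : Set V} {s : V} :
    s ∈ G.openNeighborhood U ↔ (∃ v ∈ U, G.Adj v s) ∧ s ∉ U := by
  simp [openNeighborhood]

theorem openNeighborhood_verts_subset (Γ : G.SepComponent S) :
    G.openNeighborhood Γ.verts ⊆ S := by
  intro s hs
  obtain ⟨⟨v, hv, hvs⟩, hs⟩ := mem_openNeighborhood.1 hs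
  by_contra h
  exact hs (mem_verts_of_adj hv hvs h)

theorem mem_fullComponents {Γ : G.SepComponent S} :
    Γ ∈ G.fullComponents S ↔ ∀ s ∈ S, ∃ v ∈ Γ.verts, G.Adj v s := by
  constructor
  · intro h s hs
    have h : G.openNeighborhood Γ.verts = S := h
    exact (mem_openNeighborhood.1 (h.ge hs)).1
  · intro h
    refine (openNeighborhood_verts_subset Γ).antisymm fun s hs => ?_
    exact mem_openNeighborhood.2 ⟨h s hs, fun h' => notMem_of_mem_verts h' hs⟩

theorem separates_iff {a b : V} : G.Separates S a b ↔
    a ∉ S ∧ b ∉ S ∧ ∀ Γ : G.SepComponent S, a ∈ Γ.verts → b ∉ Γ.verts := by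
  constructor
  · rintro ⟨ha, hb, h⟩
    refine ⟨ha, hb, fun Γ h1 h2 => h ?_⟩
    obtain ⟨_, rfl⟩ := mem_verts_iff.1 h1
    exact ConnectedComponent.exact (mem_verts_iff.1 h2).2.symm
  · rintro ⟨ha, hb, h⟩
    refine ⟨ha, hb, fun hr => h _ (mem_verts_mk ha) ?_⟩
    exact mem_verts_iff.2 ⟨hb, ConnectedComponent.sound hr.symm⟩

theorem separates_of_closed {U : Set V} {a b : V} (ha : a ∉ S) (hb : b ∉ S) (haU : a ∈ U)
    (hbU : b ∉ U) (hU : ∀ x ∈ U, ∀ y ∉ S, G.Adj x y → y ∈ U) : G.Separates S a b :=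
  separates_iff.2 ⟨ha, hb, fun _ h1 h2 => hbU (verts_subset_of_closed h1 haU hU h2)⟩

theorem Separates.symm {a b : V} (h : G.Separates S a b) : G.Separates S b a := by
  obtain ⟨ha, hb, h⟩ := h
  exact ⟨hb, ha, fun h' => h h'.symm⟩

theorem separates_openNeighborhood {Γ : G.SepComponent S} {a b : V} (ha : a ∈ Γ.verts)
    (hb : b ∉ Γ.verts) (hbN : b ∉ G.openNeighborhood Γ.verts) :
    G.Separates (G.openNeighborhood Γ.verts) a b := by
  refine separates_of_closed (fun h => (mem_openNeighborhood.1 h).2 ha) hbN ha hb ?_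
  intro x hx y hy hxy
  by_contra h
  exact hy (mem_openNeighborhood.2 ⟨⟨x, hx, hxy⟩, h⟩)

/-- Minimal vertex separators have at least two full components. -/
theorem exists_fullComponents_of_mem (hS : S ∈ G.minimalVertexSeparators) :
    ∃ Γ ∈ G.fullComponents S, ∃ Γ' ∈ G.fullComponents S, Γ ≠ Γ' := by
  obtain ⟨a, b, hab, hmin⟩ := hS
  obtain ⟨ha, hb, h⟩ := separates_iff.1 hab
  have key : ∀ a b : V, ∀ ha : a ∉ S, G.Separates S a b → (∀ T, G.Separates T a b → T ≤ S → S ≤ T) →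
      G.sepComponentMk a ha ∈ G.fullComponents S := by
    intro a b ha hab hmin
    obtain ⟨_, hb, h⟩ := separates_iff.1 hab
    have hsub := openNeighborhood_verts_subset (G.sepComponentMk a ha)
    refine hsub.antisymm (hmin _ ?_ hsub)
    exact separates_openNeighborhood (mem_verts_mk ha) (h _ (mem_verts_mk ha)) fun hb' => hb (hsub hb')
  refine ⟨_, key a b ha hab fun T hT => hmin hT, _, key b a hb hab.symm fun T hT => hmin hT.symm, ?_⟩
  intro heq
  exact h _ (mem_verts_mk ha) (heq ▸ mem_verts_mk hb)

/-- Any `s ∈ S` omitted from a smaller set has neighbours in both components and so reconnects them.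
-/
theorem mem_minimalVertexSeparators_of_ne {Γ Γ' : G.SepComponent S} (hΓ : Γ ∈ G.fullComponents S)
    (hΓ' : Γ' ∈ G.fullComponents S) (hne : Γ ≠ Γ') : S ∈ G.minimalVertexSeparators := by
  obtain ⟨a, ha⟩ := verts_nonempty Γ
  obtain ⟨b, hb⟩ := verts_nonempty Γ'
  refine ⟨a, b, separates_iff.2 ⟨notMem_of_mem_verts ha, notMem_of_mem_verts hb, ?_⟩, ?_⟩
  · intro Δ h1 h2
    exact hne ((eq_of_mem ha h1).trans (eq_of_mem h2 hb))
  · intro T hT hTS s hs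
    by_contra hsT
    obtain ⟨haT, -, h⟩ := separates_iff.1 hT
    obtain ⟨v, hv, hvs⟩ := mem_fullComponents.1 hΓ s hs
    obtain ⟨w, hw, hws⟩ := mem_fullComponents.1 hΓ' s hs
    have h1 := mem_verts_mk (G := G) haT
    have h2 := verts_subset_verts (fun x hx hxT => notMem_of_mem_verts hx (hTS hxT)) ha h1 hv
    have h3 := mem_verts_of_adj (mem_verts_of_adj h2 hvs hsT) hws.symm
      fun hxT => notMem_of_mem_verts hw (hTS hxT)
    exact h _ h1 (verts_subset_verts (fun x hx hxT => notMem_of_mem_verts hx (hTS hxT)) hw h3 hb)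

/-- The neighbourhood `T` of a component is a minimal vertex separator as soon as all of `T` has
neighbours in some other component of `G(V ∖ T)`. -/
theorem openNeighborhood_mem_minimalVertexSeparators {Γ : G.SepComponent S} {a : V}
    (ha : a ∉ Γ.verts) (haT : a ∉ G.openNeighborhood Γ.verts)
    (hfull : G.sepComponentMk a haT ∈ G.fullComponents (G.openNeighborhood Γ.verts)) :
    G.openNeighborhood Γ.verts ∈ G.minimalVertexSeparators := by
  obtain ⟨b, hb⟩ := verts_nonempty Γ
  have hsep := separates_openNeighborhood hb ha haT
  obtain ⟨hbT, -, h⟩ := separates_iff.1 hsep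
  have hsub : Γ.verts ⊆ (G.sepComponentMk b hbT).verts :=
    verts_subset_verts (fun x hx hxT => (mem_openNeighborhood.1 hxT).2 hx) hb (mem_verts_mk hbT)
  refine mem_minimalVertexSeparators_of_ne (Γ := G.sepComponentMk b hbT) ?_ hfull ?_
  · refine mem_fullComponents.2 fun t ht => ?_
    obtain ⟨v, hv, hvt⟩ := (mem_openNeighborhood.1 ht).1
    exact ⟨v, hsub hv, hvt⟩
  · intro heq
    exact h _ (mem_verts_mk hbT) (heq ▸ mem_verts_mk haT)

/-! ### Cliques and separators in chordal graphs -/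

/-- A clique meeting a component `Γ` of `G(V ∖ S)` is contained in `Γ ∪ S`. -/
theorem IsClique.subset_verts_union (hC : G.IsClique C) {Γ : G.SepComponent S} {a : V} (haC : a ∈ C)
    (ha : a ∈ Γ.verts) : C ⊆ Γ.verts ∪ S := by
  intro c hc
  by_cases hcS : c ∈ S
  · exact Or.inr hcS
  · rcases eq_or_ne a c with rfl | hne
    · exact Or.inl ha
    · exact Or.inl (mem_verts_of_adj ha (hC haC hc hne) hcS)

theorem reachable_insert_insert {A : Set V} {x y v w : V} (hv : v ∈ A) (hw : w ∈ A)
    (hxv : G.Adj x v) (hwy : G.Adj w y) (h : (G.induce A).Reachable ⟨v, hv⟩ ⟨w, hw⟩) :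
    (G.induce (insert x (insert y A))).Reachable ⟨x, by simp⟩ ⟨y, by simp⟩ := by
  have hsub : A ⊆ insert x (insert y A) := (Set.subset_insert _ _).trans (Set.subset_insert _ _)
  exact (hxv.reachable_induce (by simp) (hsub hv)).trans
    ((h.induce_mono hsub).trans (hwy.reachable_induce (hsub hw) (by simp)))

/-- Minimal vertex separators of a chordal graph are cliques. -/
theorem IsChordal.isClique_of_mem (hG : G.IsChordal) (hS : S ∈ G.minimalVertexSeparators) :
    G.IsClique S := by
  obtain ⟨Γ, hΓ, Γ', hΓ', hne⟩ := exists_fullComponents_of_mem hS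
  have hreach : ∀ Δ ∈ G.fullComponents S, ∀ x ∈ S, ∀ y ∈ S,
      (G.induce (insert x (insert y Δ.verts))).Reachable ⟨x, by simp⟩ ⟨y, by simp⟩ := by
    intro Δ hΔ x hx y hy
    obtain ⟨v, hv, hvx⟩ := mem_fullComponents.1 hΔ x hx
    obtain ⟨w, hw, hwy⟩ := mem_fullComponents.1 hΔ y hy
    exact reachable_insert_insert hv hw hvx.symm hwy (SepComponent.reachable_induce hv hw)
  intro x hx y hy hxy
  refine hG.adj_of_reachable hxy (A := Γ.verts) (B := Γ'.verts) ?_ ?_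
    (hreach Γ hΓ x hx y hy) (hreach Γ' hΓ' x hx y hy)
  · exact Set.disjoint_left.2 fun a h h' => hne (eq_of_mem h h')
  · intro a ha b hb hab
    exact hne (eq_of_mem (mem_verts_of_adj ha hab (notMem_of_mem_verts hb)) hb)

/-- In a chordal graph, a component all of whose neighbours form a clique `S` contains a vertex
adjacent to all of `S`. -/
theorem IsChordal.exists_adj_all [Finite V] (hG : G.IsChordal) (hS : G.IsClique S)
    {Γ : G.SepComponent S} (hΓ : Γ ∈ G.fullComponents S) :
    ∃ v ∈ Γ.verts, ∀ s ∈ S, G.Adj v s := by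
  -- Take `v` with the most neighbours in `S`. If it misses `s`, leave its component of the
  -- non-neighbours of `s` in `Γ` at a neighbour `w` of `s`; `w` will have strictly more neighbours
  -- in `S`.
  obtain ⟨v, hv, hmax⟩ := Set.exists_max_image Γ.verts (fun v => {s ∈ S | G.Adj v s}.ncard)
    (Set.toFinite _) (verts_nonempty Γ)
  refine ⟨v, hv, fun s hs => ?_⟩
  by_contra hvs
  set A : Set V := {x ∈ Γ.verts | ¬ G.Adj x s} with hA
  have hvA : v ∈ A := ⟨hv, hvs⟩
  obtain ⟨u, hu, hus⟩ := mem_fullComponents.1 hΓ s hs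
  obtain ⟨x, hxA, hvx, w, hxw, hw, hws⟩ : ∃ x, ∃ hxA : x ∈ A,
      (G.induce A).Reachable ⟨v, hvA⟩ ⟨x, hxA⟩ ∧ ∃ w, G.Adj x w ∧ w ∈ Γ.verts ∧ G.Adj w s := by
    by_contra! hcon
    have hsub : Γ.verts ⊆ {x | ∃ hxA : x ∈ A, (G.induce A).Reachable ⟨v, hvA⟩ ⟨x, hxA⟩} := by
      refine verts_subset_of_closed hv ⟨hvA, Reachable.refl _⟩ ?_
      rintro x ⟨hxA, hr⟩ y hy hxy
      have hyΓ := mem_verts_of_adj hxA.1 hxy hy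
      have hyA : y ∈ A := ⟨hyΓ, hcon x hxA hr y hxy hyΓ⟩
      exact ⟨hyA, hr.trans (hxy.reachable_induce hxA hyA)⟩
    exact (hsub hu).1.2 hus
  have hlt : {t ∈ S | G.Adj v t} ⊂ {t ∈ S | G.Adj w t} := by
    refine (Set.ssubset_iff_of_subset ?_).2 ⟨s, ⟨hs, hws⟩, fun h => hvs h.2⟩
    rintro t ⟨ht, hvt⟩
    refine ⟨ht, ?_⟩
    have hts : t ≠ s := by rintro rfl; exact hvs hvt
    -- Two routes join `t` to `w`: through `v` and `A`, and through `s`, which has no neighbour in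
    -- `A`.
    refine (hG.adj_of_reachable (A := A) (B := {s}) ?_ ?_ ?_
      (reachable_insert_insert hvA hxA hvt.symm hxw hvx)
      (reachable_insert_insert rfl rfl (hS ht hs hts) hws.symm (Reachable.refl _))).symm
    · rintro rfl
      exact notMem_of_mem_verts hw ht
    · exact Set.disjoint_singleton_right.2 fun h => notMem_of_mem_verts h.1 hs
    · rintro a ha b rfl
      exact ha.2
  exact (Set.ncard_lt_ncard hlt).not_ge (hmax w hw)

theorem IsChordal.cliquesAbove_nonempty [Finite V] (hG : G.IsChordal) (hS : G.IsClique S)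
    {Γ : G.SepComponent S} (hΓ : Γ ∈ G.fullComponents S) : (G.cliquesAbove S Γ).Nonempty := by
  obtain ⟨v, hv, hadj⟩ := hG.exists_adj_all hS hΓ
  obtain ⟨C, hSC, hC⟩ := Finite.exists_le_maximal (hS.insert (a := v) fun s hs _ => hadj s hs)
  have hvC : v ∈ C := hSC (Set.mem_insert _ _)
  refine ⟨C, hC, hC.prop.subset_verts_union hvC hv, ?_⟩
  exact (Set.ssubset_iff_of_subset ((Set.subset_insert _ _).trans hSC)).2
    ⟨v, hvC, notMem_of_mem_verts hv⟩

theorem mem_fullComponents_of_mem_cliquesAbove {Γ : G.SepComponent S} (h : C ∈ G.cliquesAbove S Γ) :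
    Γ ∈ G.fullComponents S := by
  obtain ⟨hC, hCΓ, hSC⟩ := h
  obtain ⟨v, hv, hvS⟩ := Set.exists_of_ssubset hSC
  refine mem_fullComponents.2 fun s hs => ⟨v, (hCΓ hv).resolve_right hvS, ?_⟩
  exact hC.prop hv (hSC.1 hs) (by rintro rfl; exact hvS hs)

/-- If `S` is a minimal vertex separator, a maximal clique is not contained in it. -/
theorem IsChordal.exists_mem_notMem [Finite V] (hG : G.IsChordal)
    (hS : S ∈ G.minimalVertexSeparators) (hC : C ∈ G.maximalCliques) : ∃ c ∈ C, c ∉ S := by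
  obtain ⟨Γ, hΓ, -⟩ := exists_fullComponents_of_mem hS
  obtain ⟨D, hD, -, hSD⟩ := hG.cliquesAbove_nonempty (hG.isClique_of_mem hS) hΓ
  by_contra! h
  have hC : Maximal G.IsClique C := hC
  have hCS : C ⊆ S := h
  exact hSD.2 ((hC.2 hD.prop (hCS.trans hSD.1)).trans hCS)

/-! ### Consequences of the antichain condition, and a criterion for it -/

/-- If the minimal vertex separators form an antichain, all components are full. -/
theorem mem_fullComponents_of_isAntichain
    (hanti : IsAntichain (· ⊆ ·) G.minimalVertexSeparators) (hS : S ∈ G.minimalVertexSeparators)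
    (Γ : G.SepComponent S) : Γ ∈ G.fullComponents S := by
  by_contra hΓ
  have hsub := openNeighborhood_verts_subset Γ
  have hne : G.openNeighborhood Γ.verts ≠ S := hΓ
  obtain ⟨s, hs, hsN⟩ := Set.exists_of_ssubset (hsub.ssubset_of_ne hne)
  obtain ⟨Δ, hΔ, -⟩ := exists_fullComponents_of_mem hS
  -- Outside the neighbourhood of `Γ`, the vertex `s` is joined to the full component `Δ`, which
  -- sees all of that neighbourhood.
  refine hne (hanti.eq (openNeighborhood_mem_minimalVertexSeparators
    (fun h => notMem_of_mem_verts h hs) hsN ?_) hS hsub)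
  refine mem_fullComponents.2 fun t ht => ?_
  obtain ⟨v, hv, hvs⟩ := mem_fullComponents.1 hΔ s hs
  obtain ⟨w, hw, hwt⟩ := mem_fullComponents.1 hΔ t (hsub ht)
  have hΔN : ∀ x ∈ Δ.verts, x ∉ G.openNeighborhood Γ.verts :=
    fun x hx hxN => notMem_of_mem_verts hx (hsub hxN)
  exact ⟨w, verts_subset_verts hΔN hv
    (mem_verts_of_adj (mem_verts_mk hsN) hvs.symm (hΔN v hv)) hw, hwt⟩

theorem exists_not_adj_of_ne {D : Set V} (hC : C ∈ G.maximalCliques) (hD : D ∈ G.maximalCliques)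
    (hne : C ≠ D) : ∃ a ∈ C, a ∉ D ∧ ∃ b ∈ D, a ≠ b ∧ ¬ G.Adj a b := by
  have hC : Maximal G.IsClique C := hC
  have hD : Maximal G.IsClique D := hD
  obtain ⟨a, ha, haD⟩ : ∃ a ∈ C, a ∉ D := by
    by_contra! h
    exact hne (Set.Subset.antisymm h (hC.2 hD.prop h))
  refine ⟨a, ha, haD, ?_⟩
  by_contra! h
  exact haD (hD.2 (hD.prop.insert h) (Set.subset_insert _ _) (Set.mem_insert _ _))

/-- If the minimal vertex separators form an antichain, at most one maximal clique lies above a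
minimal vertex separator within a component. -/
theorem cliquesAbove_subsingleton [Finite V]
    (hanti : IsAntichain (· ⊆ ·) G.minimalVertexSeparators) (hS : S ∈ G.minimalVertexSeparators)
    (Γ : G.SepComponent S) : (G.cliquesAbove S Γ).Subsingleton := by
  rintro C ⟨hC, hCΓ, hSC⟩ D ⟨hD, hDΓ, hSD⟩
  by_contra hne
  obtain ⟨a, ha, haD, b, hb, hab, hnadj⟩ := exists_not_adj_of_ne hC hD hne
  have hsep : G.Separates {a, b}ᶜ a b := by
    refine separates_of_closed (U := {a}) (by simp) (by simp) rfl (by simpa using hab.symm) ?_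
    rintro x rfl y hy hxy
    simp only [Set.mem_compl_iff, not_not, Set.mem_insert_iff, Set.mem_singleton_iff] at hy
    rcases hy with rfl | rfl
    · rfl
    · exact absurd hxy hnadj
  obtain ⟨T, -, hT⟩ := Finite.exists_le_minimal (p := fun T => G.Separates T a b) hsep
  obtain ⟨haT, hbT, h⟩ := separates_iff.1 hT.prop
  -- Each vertex of `S` is a common neighbour of `a` and `b`.
  have hST : S ⊆ T := by
    intro c hc
    by_contra hcT
    have hac : G.Adj a c := hC.prop ha (hSC.1 hc) (by rintro rfl; exact haD (hSD.1 hc))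
    have hcb : G.Adj c b := hD.prop (hSD.1 hc) hb (by rintro rfl; exact hnadj hac)
    exact h _ (mem_verts_mk haT) (mem_verts_of_adj (mem_verts_of_adj (mem_verts_mk haT) hac hcT) hcb hbT)
  obtain rfl : S = T := hanti.eq hS ⟨a, b, hT⟩ hST
  exact h Γ ((hCΓ ha).resolve_right haT) ((hDΓ hb).resolve_right hbT)

theorem IsChordal.ncard_cliquesAbove [Finite V] (hG : G.IsChordal)
    (hanti : IsAntichain (· ⊆ ·) G.minimalVertexSeparators) (hS : S ∈ G.minimalVertexSeparators)
    (Γ : G.SepComponent S) : (G.cliquesAbove S Γ).ncard = 1 := by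
  obtain ⟨C, hC⟩ := hG.cliquesAbove_nonempty (hG.isClique_of_mem hS)
    (mem_fullComponents_of_isAntichain hanti hS Γ)
  exact Set.ncard_eq_one.2 ⟨C, (cliquesAbove_subsingleton hanti hS Γ).eq_singleton_of_mem hC⟩

/-- If there is a unique clique above each minimal vertex separator within each full component,
then the minimal vertex separators form an antichain. -/
theorem IsChordal.isAntichain_of_ncard_cliquesAbove [Finite V] (hG : G.IsChordal)
    (h : ∀ S ∈ G.minimalVertexSeparators, ∀ Γ ∈ G.fullComponents S,
      (G.cliquesAbove S Γ).ncard = 1) :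
    IsAntichain (· ⊆ ·) G.minimalVertexSeparators := by
  intro T hT S hS hne (hsub : T ⊆ S)
  have hcl := hG.isClique_of_mem hS
  obtain ⟨s, hs, hsT⟩ := Set.exists_of_ssubset (hsub.ssubset_of_ne hne)
  obtain ⟨Γ, hΓ, Γ', hΓ', hneΓ⟩ := exists_fullComponents_of_mem hS
  have key : ∀ Δ ∈ G.fullComponents S, ∀ C ∈ G.cliquesAbove S Δ,
      C ∈ G.cliquesAbove T (G.sepComponentMk s hsT) := by
    rintro Δ hΔ C ⟨hC, hCΔ, hSC⟩
    exact ⟨hC, hC.prop.subset_verts_union (hSC.1 hs) (mem_verts_mk hsT),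
      hsub.trans_ssubset hSC⟩
  obtain ⟨C, hC⟩ := hG.cliquesAbove_nonempty hcl hΓ
  obtain ⟨D, hD⟩ := hG.cliquesAbove_nonempty hcl hΓ'
  have hCT := key Γ hΓ C hC
  have hDT := key Γ' hΓ' D hD
  obtain ⟨E, hE⟩ := Set.ncard_eq_one.1 (h T hT _ (mem_fullComponents_of_mem_cliquesAbove hCT))
  rw [hE, Set.mem_singleton_iff] at hCT hDT
  obtain ⟨v, hv, hvS⟩ := Set.exists_of_ssubset hC.2.2
  refine hneΓ (eq_of_mem ((hC.2.1 hv).resolve_right hvS) ((hD.2.1 ?_).resolve_right hvS))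
  rwa [hDT, ← hCT]

/-! ### Counting maximal cliques -/

/-- For distinct maximal cliques `C` and `C₀` of a chordal graph, some minimal vertex separator
properly contained in `C` separates the rest of `C` from `C₀`. -/
theorem IsChordal.exists_separator_subset [Finite V] (hG : G.IsChordal) {C₀ : Set V}
    (hC : C ∈ G.maximalCliques) (hC₀ : C₀ ∈ G.maximalCliques) (hne : C ≠ C₀) :
    ∃ S ∈ G.minimalVertexSeparators, ∃ Γ : G.SepComponent S, C ∈ G.cliquesAbove S Γ ∧
      ¬ C₀ ⊆ Γ.verts ∪ S := by
  obtain ⟨b, hb, hbC, -⟩ := exists_not_adj_of_ne hC₀ hC hne.symm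
  set Γ := G.sepComponentMk b hbC with hΓ
  have hbΓ : b ∈ Γ.verts := mem_verts_mk hbC
  have hsub := openNeighborhood_verts_subset Γ
  -- Otherwise `Γ` is full for `C`, and a vertex adjacent to all of `C` contradicts maximality.
  obtain ⟨a, ha, haN⟩ : ∃ a ∈ C, a ∉ G.openNeighborhood Γ.verts := by
    by_contra! hcon
    obtain ⟨v, hv, hadj⟩ := hG.exists_adj_all hC.prop (hsub.antisymm hcon)
    have hins : G.IsClique (insert v C) := hC.prop.insert fun s hs _ => hadj s hs
    exact notMem_of_mem_verts hv
      ((show Maximal G.IsClique C from hC).2 hins (Set.subset_insert _ _) (Set.mem_insert _ _))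
  have haΓ : a ∉ Γ.verts := fun h => notMem_of_mem_verts h ha
  have hS := openNeighborhood_mem_minimalVertexSeparators haΓ haN <| mem_fullComponents.2
    fun t ht => ⟨a, mem_verts_mk haN, hC.prop ha (hsub ht) (by rintro rfl; exact haN ht)⟩
  refine ⟨_, hS, G.sepComponentMk a haN, ⟨hC, hC.prop.subset_verts_union ha (mem_verts_mk haN),
    (Set.ssubset_iff_of_subset hsub).2 ⟨a, ha, haN⟩⟩, fun hsub₀ => ?_⟩
  obtain ⟨hbN, -, h⟩ := separates_iff.1 (separates_openNeighborhood hbΓ haΓ haN)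
  exact h _ ((hsub₀ hb).resolve_right hbN) (mem_verts_mk haN)

/-- If the minimal vertex separators form an antichain, a maximal clique has at most one minimal
vertex separator properly inside it that separates it from `C₀`. -/
theorem separator_subset_unique (hanti : IsAntichain (· ⊆ ·) G.minimalVertexSeparators)
    {C₀ : Set V} (hC₀ : G.IsClique C₀) (hS : S ∈ G.minimalVertexSeparators)
    (hT : T ∈ G.minimalVertexSeparators) {Γ : G.SepComponent S} {Δ : G.SepComponent T}
    (hCΓ : C ∈ G.cliquesAbove S Γ) (hCΔ : C ∈ G.cliquesAbove T Δ)
    (hΓ : ¬ C₀ ⊆ Γ.verts ∪ S) (hΔ : ¬ C₀ ⊆ Δ.verts ∪ T) : S = T := by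
  by_contra hne
  obtain ⟨t, ht, htS⟩ : ∃ t ∈ T, t ∉ S := by
    by_contra! h
    exact hne (hanti.eq hT hS h).symm
  obtain ⟨c, hc, hcΔ⟩ := Set.not_subset.1 hΔ
  simp only [Set.mem_union, not_or] at hcΔ
  have htΓ : t ∈ Γ.verts := (hCΓ.2.1 (hCΔ.2.2.1 ht)).resolve_right htS
  obtain ⟨v, hv, hvt⟩ :=
    mem_fullComponents.1 (mem_fullComponents_of_isAntichain hanti hT (G.sepComponentMk c hcΔ.2)) t ht
  -- Since `S ⊆ C ⊆ Δ ∪ T`, the component of `c` avoids `S`. Being full it touches `t ∈ Γ`, which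
  -- puts `c`, hence `C₀`, on the side of `Γ`.
  have havoid : ∀ x ∈ (G.sepComponentMk c hcΔ.2).verts, x ∉ S := by
    intro x hx hxS
    have hxΔ := (hCΔ.2.1 (hCΓ.2.2.1 hxS)).resolve_right (notMem_of_mem_verts hx)
    exact hcΔ.1 (eq_of_mem hx hxΔ ▸ mem_verts_mk hcΔ.2)
  have hcΓ := verts_subset_verts havoid hv (mem_verts_of_adj htΓ hvt.symm (havoid v hv))
    (mem_verts_mk hcΔ.2)
  exact hΓ (hC₀.subset_verts_union hc hcΓ)

/-- If the minimal vertex separators of a chordal graph form an antichain, then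
`|𝒞| - 1 = ∑ S ∈ 𝒮, (|ℳ_S| - 1)`. -/
theorem IsChordal.ncard_maximalCliques [Finite V] (hG : G.IsChordal)
    (hanti : IsAntichain (· ⊆ ·) G.minimalVertexSeparators) :
    G.maximalCliques.ncard - 1 =
      ∑ᶠ S ∈ G.minimalVertexSeparators, ((G.fullComponents S).ncard - 1) := by
  have := Fintype.ofFinite G.minimalVertexSeparators
  obtain ⟨C₀, -, hC₀⟩ := Finite.exists_le_maximal (p := G.IsClique) (a := ∅) (by simp)
  have hC₀' : C₀ ∈ G.maximalCliques := hC₀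
  let I := Σ S : G.minimalVertexSeparators, {Γ : G.SepComponent S.1 // ¬ C₀ ⊆ Γ.verts ∪ S.1}
  have hex : ∀ i : I, ∃ C, C ∈ G.cliquesAbove i.1.1 i.2.1 := fun i =>
    hG.cliquesAbove_nonempty (hG.isClique_of_mem i.1.2)
      (mem_fullComponents_of_isAntichain hanti i.1.2 _)
  choose f hf using hex
  have hbij : Function.Bijective
      (fun i : I => (⟨f i, (hf i).1, fun h => i.2.2 ((Set.mem_singleton_iff.1 h).ge.trans (hf i).2.1)⟩ :
        (G.maximalCliques \ {C₀} : Set (Set V)))) := by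
    constructor
    · rintro ⟨⟨S, hS⟩, Γ, hΓ⟩ ⟨⟨T, hT⟩, Δ, hΔ⟩ heq
      have heq := congrArg Subtype.val heq
      dsimp only at heq
      have h1 := hf ⟨⟨S, hS⟩, Γ, hΓ⟩
      have h2 := hf ⟨⟨T, hT⟩, Δ, hΔ⟩
      rw [← heq] at h2
      dsimp only at h1 h2
      obtain rfl := separator_subset_unique hanti hC₀.prop hS hT h1 h2 hΓ hΔ
      obtain ⟨v, hv, hvS⟩ := Set.exists_of_ssubset h1.2.2
      obtain rfl := eq_of_mem ((h1.2.1 hv).resolve_right hvS) ((h2.2.1 hv).resolve_right hvS)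
      rfl
    · rintro ⟨C, hC, hne⟩
      obtain ⟨S, hS, Γ, hCΓ, hΓ⟩ := hG.exists_separator_subset hC hC₀' hne
      exact ⟨⟨⟨S, hS⟩, Γ, hΓ⟩, Subtype.ext (cliquesAbove_subsingleton hanti hS Γ (hf _) hCΓ)⟩
  have hcard := Nat.card_eq_of_bijective _ hbij
  -- Only the component that meets `C₀` is excluded.
  have hcount : ∀ S ∈ G.minimalVertexSeparators,
      Nat.card {Γ : G.SepComponent S // ¬ C₀ ⊆ Γ.verts ∪ S} = (G.fullComponents S).ncard - 1 := by
    intro S hS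
    obtain ⟨c, hc, hcS⟩ := hG.exists_mem_notMem hS hC₀'
    rw [show G.fullComponents S = Set.univ from
      Set.eq_univ_of_forall (mem_fullComponents_of_isAntichain hanti hS),
      ← Set.ncard_sdiff_singleton_of_mem (Set.mem_univ (G.sepComponentMk c hcS)),
      ← Nat.card_coe_set_eq]
    refine Nat.card_congr (Equiv.subtypeEquivRight fun Γ => ?_)
    simp only [Set.mem_sdiff, Set.mem_univ, true_and, Set.mem_singleton_iff]
    refine not_congr ⟨fun h => ?_, ?_⟩
    · exact eq_of_mem ((h hc).resolve_right hcS) (mem_verts_mk hcS)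
    · rintro rfl
      exact hC₀.prop.subset_verts_union hc (mem_verts_mk hcS)
  rw [← Set.ncard_sdiff_singleton_of_mem hC₀', ← Nat.card_coe_set_eq, ← hcard, Nat.card_sigma,
    ← finsum_eq_sum_of_fintype, ← finsum_set_coe_eq_finsum_mem]
  exact finsum_congr fun S => hcount S S.2

theorem IsChordal.uniquenessConditions_iff [Finite V] (hG : G.IsChordal) :
    G.UniquenessConditions ↔ IsAntichain (· ⊆ ·) G.minimalVertexSeparators ∧
      ∀ S ∈ G.minimalVertexSeparators, (G.fullComponents S).ncard = 2 := by
  rw [UniquenessConditions, and_comm]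
  refine and_congr_right fun hanti => ?_
  have hformula := hG.ncard_maximalCliques hanti
  have hpos : 0 < G.maximalCliques.ncard := by
    obtain ⟨C₀, -, hC₀⟩ := Finite.exists_le_maximal (p := G.IsClique) (a := ∅) (by simp)
    exact (Set.ncard_pos).2 ⟨C₀, hC₀⟩
  have hfin := G.minimalVertexSeparators.toFinite
  rw [finsum_mem_eq_finite_toFinset_sum _ hfin] at hformula
  have hle : ∀ S ∈ hfin.toFinset, 1 ≤ (G.fullComponents S).ncard - 1 := by
    intro S hS
    obtain ⟨Γ, hΓ, Δ, hΔ, hne⟩ := exists_fullComponents_of_mem (hfin.mem_toFinset.1 hS)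
    have := (Set.one_lt_ncard).2 ⟨Γ, hΓ, Δ, hΔ, hne⟩
    omega
  have hsum := Finset.sum_eq_sum_iff_of_le hle
  rw [Finset.sum_const, smul_eq_mul, mul_one, ← Set.ncard_eq_toFinset_card _ hfin] at hsum
  have h1 : (G.minimalVertexSeparators.ncard : ℤ) = (G.maximalCliques.ncard : ℤ) - 1 ↔
      G.minimalVertexSeparators.ncard =
        ∑ S ∈ hfin.toFinset, ((G.fullComponents S).ncard - 1) := by
    rw [← hformula]
    omega
  rw [h1, hsum]
  refine forall_congr' fun S => ?_
  rw [hfin.mem_toFinset]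
  refine imp_congr_right fun _ => ?_
  omega

end SimpleGraph

theorem mainTheorem8 {V : Type*} [Finite V] (G : SimpleGraph V) (hconn : G.Connected)
    (hchordal : G.IsChordal) :
    (G.UniquenessConditions ↔
      ∀ S ∈ G.minimalVertexSeparators,
        (G.fullComponents S).ncard = 2 ∧
          ∀ Γ : G.SepComponent S, (G.cliquesAbove S Γ).ncard = 1) ∧
    (G.UniquenessConditions ↔
      ∀ S ∈ G.minimalVertexSeparators,
        (G.fullComponents S).ncard = 2 ∧
          ∀ Γ ∈ G.fullComponents S, (G.cliquesAbove S Γ).ncard = 1) ∧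
    (G.UniquenessConditions →
      ∀ S ∈ G.minimalVertexSeparators, G.hoLeeFactor S = 1) := by
  have hfwd : G.UniquenessConditions → ∀ S ∈ G.minimalVertexSeparators,
      (G.fullComponents S).ncard = 2 ∧ ∀ Γ : G.SepComponent S, (G.cliquesAbove S Γ).ncard = 1 := by
    intro h S hS
    obtain ⟨hanti, h2⟩ := hchordal.uniquenessConditions_iff.1 h
    exact ⟨h2 S hS, fun Γ => hchordal.ncard_cliquesAbove hanti hS Γ⟩
  have hbwd : (∀ S ∈ G.minimalVertexSeparators, (G.fullComponents S).ncard = 2 ∧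
      ∀ Γ ∈ G.fullComponents S, (G.cliquesAbove S Γ).ncard = 1) → G.UniquenessConditions :=
    fun h => hchordal.uniquenessConditions_iff.2
      ⟨hchordal.isAntichain_of_ncard_cliquesAbove fun S hS => (h S hS).2, fun S hS => (h S hS).1⟩
  refine ⟨⟨hfwd, fun h => hbwd fun S hS => ⟨(h S hS).1, fun Γ _ => (h S hS).2 Γ⟩⟩,
    ⟨fun h S hS => ⟨(hfwd h S hS).1, fun Γ _ => (hfwd h S hS).2 Γ⟩, hbwd⟩, fun h S hS => ?_⟩
  obtain ⟨h2, h1⟩ := hfwd h S hS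
  -- The exponent is `2 - 2 = 0`, and every factor of the product is 1.
  simp [SimpleGraph.hoLeeFactor, h2, h1]
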